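/- Work over $\mathbb{C}$. Let $(\mathcal L,[\cdot_\lambda\cdot],\alpha)$ be a (multiplicative) Hom-Lie conformal algebra: a $\mathbb{C}[\partial]$-module with a $\mathbb{C}$-bilinear $\lambda$-bracket $\mathcal L\otimes\mathcal L\to\mathcal L[\lambda]$ and a linear map $\alpha$ with $\alpha\partial=\partial\alpha$, $\alpha[x_\lambda y]=[\alpha(x)_\lambda\alpha(y)]$, $[\partial x_\lambda y]=-\lambda[x_\lambda y]$, $[x_\lambda\partial y]=(\partial+\lambda)[x_\lambda y]$, $[x_\lambda y]=-[y_{-\lambda-\partial}x]$ and $[\alpha(x)_\lambda[y_\mu z]]=[[x_\lambda y]_{\lambda+\mu}\alpha(z)]+[\alpha(y)_\mu[x_\lambda z]]$. Let $(\rho,\mathcal M,\beta)$ be a representation of it: a $\mathbb{C}[\partial]$-module $\mathcal M$ with a linear map $\beta$, $\beta\partial=\partial\beta$, and a bilinear map $(x,m)\mapsto\rho(x)_\lambda m\in\mathcal M[\lambda]$ with $\rho(\partial x)_\lambda=-\lambda\rho(x)_\lambda$, $\rho(x)_\lambda\partial=(\partial+\lambda)\rho(x)_\lambda$, $\beta(\rho(x)_\lambda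 m)=\rho(\alpha(x))_\lambda\beta(m)$ and $\rho([x_\lambda y])_{\lambda+\mu}\beta=\rho(\alpha(x))_\lambda\rho(y)_\mu-\rho(\alpha(y))_\mu\rho(x)_\lambda$. An $\mathcal O$-operator is a $\mathbb{C}[\partial]$-linear map $T:\mathcal M\to\mathcal L$ with $T\beta=\alpha T$ and $[T(m)_\lambda T(n)]=T(\rho(Tm)_\lambda n-\rho(Tn)_{-\partial-\lambda}m)$. Let $C^1$ be the space of $\mathbb{C}[\partial]$-linear maps $f:\mathcal M\to\mathcal L$ with $\alpha f=f\beta$, and $C^2$ the space of bilinear maps $f_\lambda:\mathcal M\otimes\mathcal M\to\mathcal L[\lambda]$ with $\alpha f_\lambda(m,n)=f_\lambda(\beta m,\beta n)$, $f_\lambda(\partial m,n)=-\lambda f_\lambda(m,n)$, $f_\lambda(m,\partial n)=(\partial+\lambda)f_\lambda(m,n)$, $f_\lambda(m,n)=-f_{-\partial-\lambda}(n,m)$. For $S,S'\in C^1$ let $\{\!\{S,S'\}\!\}\in C^2$ be $$\begin{aligned}\{\!\{S,S'\}\!\}_\lambda(m,n)={}&S(\rho(S'm)_\lambda n-\rho(S'n)_{-\partial-\lambda}m)+S'(\rho(Sm)_\lambda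 n-\rho(Sn)_{-\partial-\lambda}m)\\&-[S(m)_\lambda S'(n)]+[S(n)_{-\partial-\lambda}S'(m)],\end{aligned}$$ and for $S\in C^1$, $P\in C^2$ let, with $\lambda_3=-\partial-\lambda_1-\lambda_2$ and $\tau$ running over permutations of $\{1,2,3\}$, $$\begin{aligned}\{\!\{S,P\}\!\}_{\lambda_1,\lambda_2}(m_1,m_2,m_3)={}&\sum_{\tau(1)<\tau(2)}(-1)^\tau S\big(\rho(P_{\lambda_{\tau(1)}}(m_{\tau(1)},m_{\tau(2)}))_{\lambda_{\tau(1)}+\lambda_{\tau(2)}}\beta(m_{\tau(3)})\big)\\&+\sum_{\tau(2)<\tau(3)}(-1)^\tau[\alpha S(m_{\tau(1)})_{\lambda_{\tau(1)}}P_{\lambda_{\tau(2)}}(m_{\tau(2)},m_{\tau(3)})]\\&-\sum_{\tau}(-1)^\tau P_{\lambda_{\tau(1)}+\lambda_{\tau(2)}}(\rho(Sm_{\tau(1)})_{\lambda_{\tau(1)}}m_{\tau(2)},\beta(m_{\tau(3)})).\end{aligned}$$ For an $\mathcal O$-operator $T$ put $d_T=\{\!\{T,-\}\!\}$ and let $H^2_T(\mathcal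 M,\mathcal L)=\ker(d_T|_{C^2})/d_T(C^1)$ be the second cohomology of $T$. An order $k$ deformation of $T$ is a sum $T_t=\sum_{i=0}^k t^iT_i$ (modulo $t^{k+1}$) with $T_0=T$, $T_i\in C^1$, that is an $\mathcal O$-operator on $\mathcal L[[t]]/t^{k+1}$ with respect to $\mathcal M[[t]]/t^{k+1}$, all structure maps being extended linearly over $\mathbb{C}[[t]]/t^{k+1}$. It is extensible if there is $T_{k+1}\in C^1$ such that $\sum_{i=0}^{k+1}t^iT_i$ is an order $k+1$ deformation of $T$. **Theorem.** Let $T$ be an $\mathcal O$-operator. (1) Let $k\ge 0$ and let $T_t$ be an order $k$ deformation of $T$. Then the obstruction $$Ob_{T_t}=-\tfrac12\sum_{i+j=k+1,\ i,j\ge1}\{\!\{T_i,T_j\}\!\}\in C^2$$ is a $2$-cocycle, $d_T(Ob_{T_t})=0$, and $T_t$ is extensible if and only if its class $[Ob_{T_t}]\in H^2_T(\mathcal M,\mathcal L)$ is trivial. (2) If $H^2_T(\mathcal M,\mathcal L)=0$, then every finite order deformation of $T$ is extensible. -/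

import Mathlib

set_option maxSynthPendingDepth 3

noncomputable section

namespace HomLieConf

/-! ### Polynomials in `λ` with coefficients in a vector space -/

/-- `V[λ]`: the polynomials `∑ λⁿ vₙ` in one variable with coefficients `vₙ` in `V`. -/
abbrev LPoly (V : Type*) [AddCommGroup V] : Type _ := ℕ →₀ V

section Poly

variable {V W U : Type*} [AddCommGroup V] [Module ℂ V] [AddCommGroup W] [Module ℂ W]
  [AddCommGroup U] [Module ℂ U]

/-- Substitution of an endomorphism `A` of `V` for `λ`: `∑ λⁿ vₙ ↦ ∑ Aⁿ vₙ`. -/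
def subst (A : Module.End ℂ V) : LPoly V →ₗ[ℂ] V :=
  Finsupp.lsum ℂ fun n => A ^ n

/-- Evaluation of a polynomial in `V[λ]` at a complex number `l`. -/
def ev (l : ℂ) : LPoly V →ₗ[ℂ] V := subst (l • (1 : Module.End ℂ V))

/-- Evaluation of a polynomial `p(λ)` in `V[λ]` at `-∂ - l`, where `∂` acts on the coefficients
from the left. -/
def evDual (D : Module.End ℂ V) (l : ℂ) : LPoly V →ₗ[ℂ] V :=
  subst (-D - l • (1 : Module.End ℂ V))

/-- Application of a linear map to all coefficients. -/
def mapCoeff (f : V →ₗ[ℂ] W) : LPoly V →ₗ[ℂ] LPoly W := Finsupp.mapRange.linearMap f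

/-- Multiplication by `λ` on `V[λ]`. -/
def mulLam : Module.End ℂ (LPoly V) := Finsupp.lmapDomain V ℂ fun n => n + 1

/-- The polynomial `p(-∂ - λ)` in `V[λ]`, for `p(λ)` in `V[λ]`. -/
def reflect (D : Module.End ℂ V) : LPoly V →ₗ[ℂ] LPoly V :=
  Finsupp.lsum ℂ fun n => ((-mapCoeff D - mulLam) ^ n) ∘ₗ Finsupp.lsingle 0

@[simp] lemma subst_single (A : Module.End ℂ V) (n : ℕ) (v : V) :
    subst A (Finsupp.single n v) = (A ^ n) v := by
  simp [subst]

lemma subst_mapCoeff (f : V →ₗ[ℂ] W) (A : Module.End ℂ V) (B : Module.End ℂ W)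
    (h : ∀ v, f (A v) = B (f v)) (p : LPoly V) : subst B (mapCoeff f p) = f (subst A p) := by
  have hp : ∀ (n : ℕ) (v : V), f ((A ^ n) v) = (B ^ n) (f v) := by
    intro n
    induction n with
    | zero => intro v; simp
    | succ n ih => intro v; rw [pow_succ, pow_succ, Module.End.mul_apply, Module.End.mul_apply,
        ih, h]
  induction p using Finsupp.induction_linear with
  | zero => simp
  | add p q hp hq => simp [hp, hq]
  | single n v => simp [mapCoeff, hp]

lemma ev_mapCoeff (f : V →ₗ[ℂ] W) (l : ℂ) (p : LPoly V) :
    ev l (mapCoeff f p) = f (ev l p) :=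
  subst_mapCoeff f _ _ (by simp) p

lemma evDual_mapCoeff (f : V →ₗ[ℂ] W) (D : Module.End ℂ V) (E : Module.End ℂ W)
    (h : ∀ v, f (D v) = E (f v)) (l : ℂ) (p : LPoly V) :
    evDual E l (mapCoeff f p) = f (evDual D l p) :=
  subst_mapCoeff f _ _ (by simp [h]) p

lemma ev_mulLam (l : ℂ) (p : LPoly V) : ev l (mulLam p) = l • ev l p := by
  induction p using Finsupp.induction_linear with
  | zero => simp
  | add p q hp hq => simp [hp, hq]
  | single n v => simp [ev, mulLam, Finsupp.mapDomain_single, smul_pow, pow_succ,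
      smul_smul]

lemma subst_mulLam (B : Module.End ℂ V) (p : LPoly V) :
    subst B (mulLam p) = B (subst B p) := by
  induction p using Finsupp.induction_linear with
  | zero => simp
  | add p q hp hq => simp [hp, hq]
  | single n v => simp [mulLam, Finsupp.mapDomain_single, pow_succ', Module.End.mul_apply]

lemma subst_reflect (D B : Module.End ℂ V) (h : ∀ v, D (B v) = B (D v)) (p : LPoly V) :
    subst B (reflect D p) = subst (-D - B) p := by
  have hs : ∀ q : LPoly V, subst B ((-mapCoeff D - mulLam : Module.End ℂ (LPoly V)) q)
      = (-D - B) (subst B q) := by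
    intro q
    simp [subst_mulLam, subst_mapCoeff D B B h]
  have hn : ∀ (n : ℕ) (q : LPoly V),
      subst B (((-mapCoeff D - mulLam : Module.End ℂ (LPoly V)) ^ n) q)
        = ((-D - B) ^ n) (subst B q) := by
    intro n
    induction n with
    | zero => intro q; simp
    | succ n ih => intro q; rw [pow_succ, pow_succ, Module.End.mul_apply, Module.End.mul_apply,
        ih, hs]
  induction p using Finsupp.induction_linear with
  | zero => simp
  | add p q hp hq => simp [hp, hq]
  | single n v =>
    have h0 : subst B (Finsupp.single 0 v) = v := by simp
    simp only [reflect, Finsupp.lsum_single, LinearMap.comp_apply, Finsupp.lsingle_apply, hn, h0,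
      subst_single]

/-- The value of `p(-∂ - λ)` at `l` is the value of `p` at `-∂ - l`. -/
lemma ev_reflect (D : Module.End ℂ V) (l : ℂ) (p : LPoly V) :
    ev l (reflect D p) = evDual D l p :=
  subst_reflect D _ (by simp) p

lemma evDual_reflect (D : Module.End ℂ V) (l : ℂ) (p : LPoly V) :
    evDual D l (reflect D p) = ev l p := by
  rw [evDual, subst_reflect D _ (by simp), ev, sub_sub_cancel]

/-- A polynomial in `V[λ]` is determined by its values at the complex numbers. -/
lemma ev_injective {p q : LPoly V} (h : ∀ l, ev l p = ev l q) : p = q := by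
  rw [← sub_eq_zero]
  have h0 : ∀ l, ev l (p - q) = 0 := fun l => by rw [map_sub, h, sub_self]
  generalize p - q = r at h0
  ext n
  rw [Finsupp.zero_apply, ← Module.forall_dual_apply_eq_zero_iff ℂ]
  intro φ
  have hP : (Polynomial.ofFinsupp (AddMonoidAlgebra.ofCoeff (mapCoeff φ r)) : Polynomial ℂ) = 0 := by
    apply Polynomial.funext
    intro l
    have := congrArg φ (h0 l)
    rw [← ev_mapCoeff, map_zero] at this
    rw [Polynomial.eval_zero, ← this, Polynomial.eval_eq_sum]
    simp [ev, subst, Polynomial.sum, Polynomial.support, Polynomial.coeff, Finsupp.sum, smul_pow,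
      mul_comm]
  have := congrArg (fun P => Polynomial.coeff P n) hP
  simpa [Polynomial.coeff, mapCoeff] using this

lemma evDual_D_right (D : Module.End ℂ V) {p q : LPoly V}
    (h : ∀ l, ev l q = D (ev l p) + l • ev l p) (l : ℂ) : evDual D l q = -(l • evDual D l p) := by
  have : q = mapCoeff D p + mulLam p := ev_injective fun l => by
    rw [h, map_add, ev_mapCoeff, ev_mulLam]
  rw [this, map_add, evDual_mapCoeff D D D (fun _ => rfl), evDual, subst_mulLam]
  simp only [LinearMap.sub_apply, LinearMap.neg_apply, LinearMap.smul_apply, Module.End.one_apply]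
  generalize subst _ p = v
  abel

lemma evDual_D_left (D : Module.End ℂ V) {p q : LPoly V}
    (h : ∀ l, ev l q = -(l • ev l p)) (l : ℂ) :
    evDual D l q = D (evDual D l p) + l • evDual D l p := by
  have : q = -mulLam p := ev_injective fun l => by rw [h, map_neg, ev_mulLam]
  rw [this, map_neg, evDual, subst_mulLam]
  simp
  abel

lemma evDual_map (D : Module.End ℂ V) (E : Module.End ℂ W) (f : V →ₗ[ℂ] W)
    (hf : ∀ v, f (D v) = E (f v)) {p : LPoly V} {q : LPoly W}
    (h : ∀ l, f (ev l p) = ev l q) (l : ℂ) : f (evDual D l p) = evDual E l q := by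
  have : q = mapCoeff f p := ev_injective fun l => by rw [← h, ev_mapCoeff]
  rw [this, evDual_mapCoeff f D E hf]

end Poly

/-! ### Hom-Lie conformal algebras, representations, `O`-operators -/

/-- A (multiplicative) Hom-Lie conformal algebra structure on a complex vector space `L`;
`D` is the action of `∂`, so that `L` is a `ℂ[∂]`-module, and `br x y` is `[x_λ y]` in `L[λ]`. -/
structure HomLieConformalAlgebra (L : Type*) [AddCommGroup L] [Module ℂ L] where
  D : Module.End ℂ L
  br : L →ₗ[ℂ] L →ₗ[ℂ] LPoly L
  α : Module.End ℂ L
  α_D : ∀ x, α (D x) = D (α x)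
  br_D_left : ∀ (l : ℂ) (x y : L), ev l (br (D x) y) = -(l • ev l (br x y))
  br_D_right : ∀ (l : ℂ) (x y : L), ev l (br x (D y)) = D (ev l (br x y)) + l • ev l (br x y)
  skew : ∀ (l : ℂ) (x y : L), ev l (br x y) = -evDual D l (br y x)
  jacobi : ∀ (l μ : ℂ) (x y z : L),
    ev l (br (α x) (ev μ (br y z))) =
      ev (l + μ) (br (ev l (br x y)) (α z)) + ev μ (br (α y) (ev l (br x z)))
  mult : ∀ (l : ℂ) (x y : L), α (ev l (br x y)) = ev l (br (α x) (α y))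

/-- A representation `(ρ, M, β)` of a Hom-Lie conformal algebra; `act x m` is `ρ(x)_λ m`
in `M[λ]` and `D` is the action of `∂` on `M`. -/
structure Representation {L : Type*} [AddCommGroup L] [Module ℂ L]
    (A : HomLieConformalAlgebra L) (M : Type*) [AddCommGroup M] [Module ℂ M] where
  D : Module.End ℂ M
  act : L →ₗ[ℂ] M →ₗ[ℂ] LPoly M
  β : Module.End ℂ M
  β_D : ∀ m, β (D m) = D (β m)
  act_D_left : ∀ (l : ℂ) (x : L) (m : M), ev l (act (A.D x) m) = -(l • ev l (act x m))
  act_D_right : ∀ (l : ℂ) (x : L) (m : M),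
    ev l (act x (D m)) = D (ev l (act x m)) + l • ev l (act x m)
  equivariant : ∀ (l : ℂ) (x : L) (m : M),
    β (ev l (act x m)) = ev l (act (A.α x) (β m))
  act_br : ∀ (l μ : ℂ) (x y : L) (m : M),
    ev (l + μ) (act (ev l (A.br x y)) (β m)) =
      ev l (act (A.α x) (ev μ (act y m))) - ev μ (act (A.α y) (ev l (act x m)))

section Operators

variable {L M : Type*} [AddCommGroup L] [Module ℂ L] [AddCommGroup M] [Module ℂ M]
  {A : HomLieConformalAlgebra L} (R : Representation A M)

/-- The polynomial `ρ(T m)_λ n - ρ(T n)_{-∂-λ} m` in `M[λ]`, for a linear map `T : M → L`. -/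
def subadj (T : M →ₗ[ℂ] L) : M →ₗ[ℂ] M →ₗ[ℂ] LPoly M :=
  R.act.comp T - ((R.act.comp T).compr₂ (reflect R.D)).flip

/-- `T : M → L` is an `O`-operator with respect to the representation `(ρ, M, β)`. -/
structure IsOOperator (T : M →ₗ[ℂ] L) : Prop where
  map_D : ∀ m, T (R.D m) = A.D (T m)
  map_β : ∀ m, T (R.β m) = A.α (T m)
  eq : ∀ (l : ℂ) (m n : M), ev l (A.br (T m) (T n)) =
    T (ev l (R.act (T m) n) - evDual R.D l (R.act (T n) m))

/-! ### Cochains and the bracket in low degrees -/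

/-- The `1`-cochains `C¹(M, L)`: the `ℂ[∂]`-module homomorphisms `f` with `α f = f β`. -/
def C1 : Submodule ℂ (M →ₗ[ℂ] L) where
  carrier := {f | (∀ m, f (R.D m) = A.D (f m)) ∧ ∀ m, A.α (f m) = f (R.β m)}
  add_mem' := by
    rintro f g ⟨h1, h2⟩ ⟨h3, h4⟩
    exact ⟨fun m => by simp [h1, h3], fun m => by simp [h2, h4]⟩
  zero_mem' := by simp
  smul_mem' := by
    rintro c f ⟨h1, h2⟩
    exact ⟨fun m => by simp [h1], fun m => by simp [h2]⟩

/-- The `2`-cochains `C²(M, L)`: the bilinear maps `f_λ : M ⊗ M → L[λ]` that are compatible with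
`α` and `β`, conformally sesquilinear and conformally skew-symmetric. -/
def C2 : Submodule ℂ (M →ₗ[ℂ] M →ₗ[ℂ] LPoly L) where
  carrier := {f |
    (∀ (l : ℂ) (m n : M), A.α (ev l (f m n)) = ev l (f (R.β m) (R.β n))) ∧
    (∀ (l : ℂ) (m n : M), ev l (f (R.D m) n) = -(l • ev l (f m n))) ∧
    (∀ (l : ℂ) (m n : M), ev l (f m (R.D n)) = A.D (ev l (f m n)) + l • ev l (f m n)) ∧
    ∀ (l : ℂ) (m n : M), ev l (f m n) = -evDual A.D l (f n m)}
  add_mem' := by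
    rintro f g ⟨h1, h2, h3, h4⟩ ⟨k1, k2, k3, k4⟩
    refine ⟨fun l m n => ?_, fun l m n => ?_, fun l m n => ?_, fun l m n => ?_⟩
    · simp [h1, k1]
    · simp [h2, k2]; abel
    · simp [h3, k3]; abel
    · simp only [LinearMap.add_apply, map_add, h4 l m n, k4 l m n]; abel
  zero_mem' := by simp
  smul_mem' := by
    rintro c f ⟨h1, h2, h3, h4⟩
    refine ⟨fun l m n => ?_, fun l m n => ?_, fun l m n => ?_, fun l m n => ?_⟩
    · simp [h1]
    · simp [h2, smul_comm c l]
    · simp [h3, smul_comm c l]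
    · simp only [LinearMap.smul_apply, map_smul, h4 l m n, smul_neg]

instance : AddCommGroup (C2 R) := Submodule.addCommGroup (C2 R)

/-- The bracket `{{T, S}}` of two `1`-cochains, as a bilinear map `M ⊗ M → L[λ]`:
`T(ρ(S m)_λ n - ρ(S n)_{-∂-λ} m) + S(ρ(T m)_λ n - ρ(T n)_{-∂-λ} m)
  - [(T m)_λ (S n)] + [(T n)_{-∂-λ} (S m)]`. -/
def bracket11Raw (T S : M →ₗ[ℂ] L) : M →ₗ[ℂ] M →ₗ[ℂ] LPoly L :=
  (subadj R S).compr₂ (mapCoeff T) + (subadj R T).compr₂ (mapCoeff S)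
    - A.br.compl₁₂ T S + ((A.br.compl₁₂ T S).compr₂ (reflect A.D)).flip

lemma ev_bracket11Raw (T S : M →ₗ[ℂ] L) (l : ℂ) (m n : M) :
    ev l (bracket11Raw R T S m n) =
      T (ev l (R.act (S m) n) - evDual R.D l (R.act (S n) m))
        + S (ev l (R.act (T m) n) - evDual R.D l (R.act (T n) m))
        - ev l (A.br (T m) (S n)) + evDual A.D l (A.br (T n) (S m)) := by
  simp [bracket11Raw, subadj, ev_mapCoeff, ev_reflect]

lemma bracket11Raw_mem (T S : C1 R) : bracket11Raw R T.1 S.1 ∈ C2 R := by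
  obtain ⟨T, hT, hT'⟩ := T
  obtain ⟨S, hS, hS'⟩ := S
  have e1 := fun x m => evDual_map R.D R.D R.β R.β_D (fun l => R.equivariant l x m)
  have e2 := fun x y => evDual_map A.D A.D A.α A.α_D (fun l => A.mult l x y)
  have a1 := fun x m => evDual_D_left R.D (fun l => R.act_D_left l x m)
  have a2 := fun x m => evDual_D_right R.D (fun l => R.act_D_right l x m)
  have b1 := fun x y => evDual_D_left A.D (fun l => A.br_D_left l x y)
  have b2 := fun x y => evDual_D_right A.D (fun l => A.br_D_right l x y)
  refine ⟨fun l m n => ?_, fun l m n => ?_, fun l m n => ?_, fun l m n => ?_⟩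
  · simp only [ev_bracket11Raw, map_add, map_sub, hT', hS', R.equivariant, e1, A.mult, e2]
  · simp only [ev_bracket11Raw, map_sub, hT, hS, R.act_D_left, a2, A.br_D_left, b2,
      map_neg, map_smul, smul_add, smul_sub, neg_add, neg_sub]
    abel
  · simp only [ev_bracket11Raw, map_add, map_sub, hT, hS, R.act_D_right, a1, A.br_D_right, b1,
      map_smul, smul_add, smul_sub]
    abel
  · rw [ev_bracket11Raw]
    simp only [bracket11Raw, subadj, LinearMap.add_apply, LinearMap.sub_apply,
      LinearMap.compr₂_apply, LinearMap.flip_apply, LinearMap.comp_apply,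
      LinearMap.compl₁₂_apply, map_add, map_sub, evDual_reflect,
      evDual_mapCoeff T R.D A.D hT, evDual_mapCoeff S R.D A.D hS]
    abel

/-- The bracket `{{T, S}}` of two `1`-cochains, a `2`-cochain. -/
def bracket11 (T S : C1 R) : C2 R := ⟨bracket11Raw R T.1 S.1, bracket11Raw_mem R T S⟩

/-- The value at `(λ₁, λ₂) = (l₁, l₂)` of the bracket `{{T, P}}` of a `1`-cochain and a `2`-cochain,
a trilinear map from `M` to `L`. It is the sum of

* `∑ sgn τ T(ρ(P(m_{τ1}, m_{τ2}))_{λ_{τ1}+λ_{τ2}} β m_{τ3})` over the `(2,1)`-shuffles `τ`,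
* `∑ sgn τ [(α T m_{τ1})_{λ_{τ1}} P(m_{τ2}, m_{τ3})]` over the `(1,2)`-shuffles `τ`,
* `-∑ sgn τ P_{λ_{τ1}+λ_{τ2}}(ρ(T m_{τ1})_{λ_{τ1}} m_{τ2}, β m_{τ3})` over all permutations `τ`,

where `λ₃ = -∂ - λ₁ - λ₂`; the permutations `τ` and `τ ∘ (1 2)` are taken together
in the last sum. -/
def bracket12 (T : M →ₗ[ℂ] L) (P : M →ₗ[ℂ] M →ₗ[ℂ] LPoly L) (l₁ l₂ : ℂ) (m₁ m₂ m₃ : M) : L :=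
  (T (ev (l₁ + l₂) (R.act (ev l₁ (P m₁ m₂)) (R.β m₃)))
    - T (evDual R.D l₂ (R.act (ev l₁ (P m₁ m₃)) (R.β m₂)))
    + T (evDual R.D l₁ (R.act (ev l₂ (P m₂ m₃)) (R.β m₁))))
  + (ev l₁ (A.br (A.α (T m₁)) (ev l₂ (P m₂ m₃)))
    - ev l₂ (A.br (A.α (T m₂)) (ev l₁ (P m₁ m₃)))
    + evDual A.D (l₁ + l₂) (A.br (A.α (T m₃)) (ev l₁ (P m₁ m₂))))
  - (ev (l₁ + l₂) (P (ev l₁ (subadj R T m₁ m₂)) (R.β m₃))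
    - evDual A.D l₂ (P (ev l₁ (subadj R T m₁ m₃)) (R.β m₂))
    + evDual A.D l₁ (P (ev l₂ (subadj R T m₂ m₃)) (R.β m₁)))

/-! ### The differential `d_T = {{T, -}}` and the second cohomology -/

/-- The differential `d_T = {{T, -}} : C¹(M, L) → C²(M, L)`. -/
def d1 (T : C1 R) : C1 R →ₗ[ℂ] C2 R where
  toFun S := bracket11 R T S
  map_add' S S' := by
    apply Subtype.ext
    ext1 m; ext1 n
    refine ev_injective fun l => ?_
    simp only [bracket11, Submodule.coe_add, LinearMap.add_apply, map_add, ev_bracket11Raw,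
      map_sub]
    abel
  map_smul' c S := by
    apply Subtype.ext
    ext1 m; ext1 n
    refine ev_injective fun l => ?_
    simp only [bracket11, Submodule.coe_smul, LinearMap.smul_apply, map_smul, ev_bracket11Raw,
      map_sub, RingHom.id_apply, smul_add, smul_sub]

/-- The differential `d_T = {{T, -}}` on `C²(M, L)`; a `3`-cochain is given by its values at all
`λ₁, λ₂` in `ℂ`. -/
def d2 (T : C1 R) : C2 R →ₗ[ℂ] (ℂ → ℂ → M → M → M → L) where
  toFun P := bracket12 R T.1 P.1
  map_add' P Q := by
    funext l₁ l₂ m₁ m₂ m₃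
    simp only [bracket12, Submodule.coe_add, LinearMap.add_apply, map_add, Pi.add_apply]
    abel
  map_smul' c P := by
    funext l₁ l₂ m₁ m₂ m₃
    simp only [bracket12, Submodule.coe_smul, LinearMap.smul_apply, map_smul, Pi.smul_apply,
      RingHom.id_apply, smul_add, smul_sub]

/-- The `2`-cocycles of `T`. -/
def Z2 (T : C1 R) : Submodule ℂ (C2 R) := LinearMap.ker (d2 R T)

/-- The `2`-coboundaries of `T`. -/
def B2 (T : C1 R) : Submodule ℂ (C2 R) := LinearMap.range (d1 R T)

instance (T : C1 R) : AddCommGroup (Z2 R T) := Submodule.addCommGroup (Z2 R T)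

/-- The second cohomology `H²_T(M, L)` of the `O`-operator `T`: cocycles modulo coboundaries. -/
abbrev H2 (T : C1 R) : Type _ := Z2 R T ⧸ (B2 R T).submoduleOf (Z2 R T)

end Operators

/-! ### Extension of scalars to `ℂ[t]/(t^(k+1))`

An element `∑ tⁱ vᵢ` of `V[[t]]/t^(k+1)` is given by its coefficients `v : Fin (k + 1) → V`. -/

section Trunc

variable {V W U : Type*} [AddCommGroup V] [Module ℂ V] [AddCommGroup W] [Module ℂ W]
  [AddCommGroup U] [Module ℂ U]

/-- The map `v ↦ tⁿ v` from `V` to `V[[t]]/t^(k+1)`; it is zero for `n > k`. -/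
def tpow (k n : ℕ) : V →ₗ[ℂ] (Fin (k + 1) → V) :=
  if h : n < k + 1 then LinearMap.single ℂ (fun _ => V) ⟨n, h⟩ else 0

/-- The `ℂ[t]/t^(k+1)`-linear extension of a linear map. -/
def truncMap (k : ℕ) (f : V →ₗ[ℂ] W) : (Fin (k + 1) → V) →ₗ[ℂ] (Fin (k + 1) → W) :=
  LinearMap.pi fun i => f ∘ₗ LinearMap.proj i

/-- The `ℂ[t]/t^(k+1)`-bilinear extension of a bilinear map with values in polynomials:
`(∑ tⁱ vᵢ, ∑ tʲ wⱼ) ↦ ∑ t^(i+j) B(vᵢ, wⱼ)`. -/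
def truncBilin (k : ℕ) (B : V →ₗ[ℂ] W →ₗ[ℂ] LPoly U) :
    (Fin (k + 1) → V) →ₗ[ℂ] (Fin (k + 1) → W) →ₗ[ℂ] LPoly (Fin (k + 1) → U) :=
  ∑ i : Fin (k + 1), ∑ j : Fin (k + 1),
    (B.compl₁₂ (LinearMap.proj i : (Fin (k + 1) → V) →ₗ[ℂ] V)
      (LinearMap.proj j : (Fin (k + 1) → W) →ₗ[ℂ] W)).compr₂ (mapCoeff (tpow k (i + j)))

/-- The `ℂ[t]/t^(k+1)`-linear map `∑ tⁱ Tᵢ` from `V[[t]]/t^(k+1)` to `W[[t]]/t^(k+1)`. -/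
def series {k : ℕ} (T : Fin (k + 1) → V →ₗ[ℂ] W) : (Fin (k + 1) → V) →ₗ[ℂ] (Fin (k + 1) → W) :=
  ∑ i : Fin (k + 1), ∑ j : Fin (k + 1), tpow k (i + j) ∘ₗ T i ∘ₗ LinearMap.proj j

lemma sum_tpow (k : ℕ) (v : Fin (k + 1) → V) : ∑ i : Fin (k + 1), tpow k i (v i) = v := by
  simp only [tpow, Fin.is_lt, dite_true, Fin.eta, LinearMap.coe_single]
  exact Finset.univ_sum_single v

lemma tpow_induction {k : ℕ} {p : (Fin (k + 1) → V) → Prop} (h0 : p 0)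
    (hadd : ∀ v w, p v → p w → p (v + w)) (ht : ∀ n v, p (tpow k n v)) (v : Fin (k + 1) → V) :
    p v := by
  rw [← sum_tpow k v]
  exact Finset.sum_induction _ p hadd h0 fun i _ => ht i (v i)

lemma truncMap_tpow (k : ℕ) (f : V →ₗ[ℂ] W) (n : ℕ) (v : V) :
    truncMap k f (tpow k n v) = tpow k n (f v) := by
  unfold tpow
  split_ifs with h
  · ext i
    by_cases hi : i = ⟨n, h⟩
    · subst hi; simp [truncMap]
    · simp [truncMap, hi]
  · simp

lemma truncBilin_tpow (k : ℕ) (B : V →ₗ[ℂ] W →ₗ[ℂ] LPoly U) (a b : ℕ) (v : V) (w : W) :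
    truncBilin k B (tpow k a v) (tpow k b w) = mapCoeff (tpow k (a + b)) (B v w) := by
  have hz : mapCoeff (0 : U →ₗ[ℂ] (Fin (k + 1) → U)) = 0 := by
    ext; simp [mapCoeff]
  by_cases ha : a < k + 1
  · by_cases hb : b < k + 1
    · have h1 : (tpow k a v : Fin (k + 1) → V) = Pi.single ⟨a, ha⟩ v := by simp [tpow, ha]
      have h2 : (tpow k b w : Fin (k + 1) → W) = Pi.single ⟨b, hb⟩ w := by simp [tpow, hb]
      rw [h1, h2]
      simp only [truncBilin, LinearMap.sum_apply, LinearMap.compr₂_apply,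
        LinearMap.compl₁₂_apply, LinearMap.proj_apply]
      rw [Finset.sum_eq_single ⟨a, ha⟩, Finset.sum_eq_single ⟨b, hb⟩]
      · simp
      · intro j _ hj; simp [hj]
      · simp
      · intro i _ hi; simp [hi]
      · simp
    · have h2 : ¬ a + b < k + 1 := by omega
      rw [show (tpow k b : W →ₗ[ℂ] _) = 0 by simp only [tpow, hb, dite_false],
        show (tpow k (a + b) : U →ₗ[ℂ] _) = 0 by simp only [tpow, h2, dite_false], hz]
      simp
  · have h2 : ¬ a + b < k + 1 := by omega
    rw [show (tpow k a : V →ₗ[ℂ] _) = 0 by simp only [tpow, ha, dite_false],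
      show (tpow k (a + b) : U →ₗ[ℂ] _) = 0 by simp only [tpow, h2, dite_false], hz]
    simp

end Trunc

section Extension

variable {L M : Type*} [AddCommGroup L] [Module ℂ L] [AddCommGroup M] [Module ℂ M]

/-- The Hom-Lie conformal algebra `L[[t]]/t^(k+1)`, with `∂`, the `λ`-bracket and `α` extended
linearly over `ℂ[t]/t^(k+1)`. -/
def HomLieConformalAlgebra.trunc (A : HomLieConformalAlgebra L) (k : ℕ) :
    HomLieConformalAlgebra (Fin (k + 1) → L) where
  D := truncMap k A.D
  br := truncBilin k A.br
  α := truncMap k A.α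
  α_D x := by ext i; simp [truncMap, A.α_D]
  br_D_left l x y := by
    induction x using tpow_induction with
    | h0 => simp
    | hadd x x' h h' => simp [h, h']; abel
    | ht a x =>
      induction y using tpow_induction with
      | h0 => simp
      | hadd y y' h h' => simp [h, h']; abel
      | ht b y => simp [truncMap_tpow, truncBilin_tpow, ev_mapCoeff, A.br_D_left]
  br_D_right l x y := by
    induction x using tpow_induction with
    | h0 => simp
    | hadd x x' h h' => simp [h, h']; abel
    | ht a x =>
      induction y using tpow_induction with
      | h0 => simp
      | hadd y y' h h' => simp [h, h']; abel
      | ht b y => simp [truncMap_tpow, truncBilin_tpow, ev_mapCoeff, A.br_D_right]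
  skew l x y := by
    induction x using tpow_induction with
    | h0 => simp
    | hadd x x' h h' => simp [h, h']; abel
    | ht a x =>
      induction y using tpow_induction with
      | h0 => simp
      | hadd y y' h h' => simp [h, h']; abel
      | ht b y =>
        rw [truncBilin_tpow, truncBilin_tpow, ev_mapCoeff, A.skew, add_comm b a,
          evDual_mapCoeff _ A.D _ (fun v => (truncMap_tpow k A.D _ v).symm), map_neg]
  jacobi l μ x y z := by
    induction x using tpow_induction with
    | h0 => simp
    | hadd x x' h h' => simp only [map_add, LinearMap.add_apply, h, h']; abel
    | ht a x =>
      induction y using tpow_induction with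
      | h0 => simp
      | hadd y y' h h' => simp only [map_add, LinearMap.add_apply, h, h']; abel
      | ht b y =>
        induction z using tpow_induction with
        | h0 => simp
        | hadd z z' h h' => simp only [map_add, h, h']; abel
        | ht c z =>
          simp only [truncMap_tpow, truncBilin_tpow, ev_mapCoeff, A.jacobi l μ x y z, map_add]
          rw [← add_assoc, add_left_comm b a c, ← add_assoc]
  mult l x y := by
    induction x using tpow_induction with
    | h0 => simp
    | hadd x x' h h' => simp [h, h']
    | ht a x =>
      induction y using tpow_induction with
      | h0 => simp
      | hadd y y' h h' => simp [h, h']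
      | ht b y => simp [truncMap_tpow, truncBilin_tpow, ev_mapCoeff, A.mult]

/-- The representation of `L[[t]]/t^(k+1)` on `M[[t]]/t^(k+1)`, with `∂`, `ρ` and `β` extended
linearly over `ℂ[t]/t^(k+1)`. -/
def Representation.trunc {A : HomLieConformalAlgebra L} (R : Representation A M) (k : ℕ) :
    Representation (A.trunc k) (Fin (k + 1) → M) where
  D := truncMap k R.D
  act := truncBilin k R.act
  β := truncMap k R.β
  β_D x := by ext i; simp [truncMap, R.β_D]
  act_D_left l x y := by
    dsimp only [HomLieConformalAlgebra.trunc]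
    induction x using tpow_induction with
    | h0 => simp
    | hadd x x' h h' => simp [h, h']; abel
    | ht a x =>
      induction y using tpow_induction with
      | h0 => simp
      | hadd y y' h h' => simp [h, h']; abel
      | ht b y => simp [truncMap_tpow, truncBilin_tpow, ev_mapCoeff, R.act_D_left]
  act_D_right l x y := by
    induction x using tpow_induction with
    | h0 => simp
    | hadd x x' h h' => simp [h, h']; abel
    | ht a x =>
      induction y using tpow_induction with
      | h0 => simp
      | hadd y y' h h' => simp [h, h']; abel
      | ht b y => simp [truncMap_tpow, truncBilin_tpow, ev_mapCoeff, R.act_D_right]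
  equivariant l x y := by
    dsimp only [HomLieConformalAlgebra.trunc]
    induction x using tpow_induction with
    | h0 => simp
    | hadd x x' h h' => simp [h, h']
    | ht a x =>
      induction y using tpow_induction with
      | h0 => simp
      | hadd y y' h h' => simp [h, h']
      | ht b y => simp [truncMap_tpow, truncBilin_tpow, ev_mapCoeff, R.equivariant]
  act_br l μ x y z := by
    dsimp only [HomLieConformalAlgebra.trunc]
    induction x using tpow_induction with
    | h0 => simp
    | hadd x x' h h' => simp only [map_add, LinearMap.add_apply, h, h']; abel
    | ht a x =>
      induction y using tpow_induction with
      | h0 => simp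
      | hadd y y' h h' => simp only [map_add, LinearMap.add_apply, h, h']; abel
      | ht b y =>
        induction z using tpow_induction with
        | h0 => simp
        | hadd z z' h h' => simp only [map_add, h, h']; abel
        | ht c z =>
          simp only [truncMap_tpow, truncBilin_tpow, ev_mapCoeff, R.act_br l μ x y z, map_sub]
          rw [← add_assoc, add_left_comm b a c, ← add_assoc]

/-! ### Finite order deformations, extensibility, obstruction -/

variable {A : HomLieConformalAlgebra L} (R : Representation A M)

/-- `T₀ + t T₁ + ⋯ + tᵏ Tₖ` (modulo `t^(k+1)`) is an order `k` deformation of `T`: `T₀ = T`, and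
it is an `O`-operator on `L[[t]]/t^(k+1)` with respect to the representation `M[[t]]/t^(k+1)`. -/
structure IsDeformation (T : C1 R) (k : ℕ) (Ts : Fin (k + 1) → C1 R) : Prop where
  zero : Ts 0 = T
  isOOperator : IsOOperator (R.trunc k) (series fun i => (Ts i : M →ₗ[ℂ] L))

/-- An order `k` deformation is extensible if a term `t^(k+1) T_{k+1}` can be added to it so that
it becomes an order `k + 1` deformation. -/
def Extensible (T : C1 R) (k : ℕ) (Ts : Fin (k + 1) → C1 R) : Prop :=
  ∃ T' : C1 R, IsDeformation R T (k + 1) (Fin.snoc (α := fun _ => C1 R) Ts T')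

/-- The obstruction `Ob = -1/2 ∑_{i + j = k + 1, i, j ≥ 1} {{Tᵢ, Tⱼ}}`, a `2`-cochain. -/
def obstruction (k : ℕ) (Ts : Fin (k + 1) → C1 R) : C2 R :=
  -(1 / 2 : ℂ) • ∑ i : Fin (k + 1), ∑ j : Fin (k + 1),
    if (i : ℕ) + j = k + 1 ∧ 1 ≤ (i : ℕ) ∧ 1 ≤ (j : ℕ) then bracket11 R (Ts i) (Ts j) else 0

end Extension

end HomLieConf

end

/-!
The bracket `{{-, -}}` is the graded Lie bracket whose Maurer-Cartan elements are the
`O`-operators: a `1`-cochain `S` is an `O`-operator if and only if `{{S, S}} = 0`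
(`isOOperator_iff_bracket11_self`). Applied over `ℂ[t]/t^(k+1)`, this says that `S_t = ∑ tⁱ Sᵢ` is a
deformation of order `k` if and only if the coefficients of `tⁿ` in `{{S_t, S_t}}` vanish for
`n ≤ k` (`isOOperator_series_iff`). Adding a term `t^(k+1) S'` leaves these coefficients unchanged
and adds `2 {{S₀, S'}}` to the coefficient of `t^(k+1)`, which before was `-2 Ob`. Hence the
extension is a deformation of order `k + 1` if and only if `d_T S' = Ob`.

That `Ob` is a cocycle follows from the graded Jacobi identity in the lowest degree. On the diagonal,
`{{S, {{S, S}}}} = 0` for every `1`-cochain `S` (`d2_bracket11_self`); this is the Hom-Jacobi identity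
of `L` together with the identity of the representation at `(λ₁, λ₂)` and at two substitutions
involving `λ₃ = -∂ - λ₁ - λ₂` (`Representation.evDual_act_br`). Inserting `S = ∑ zⁱ Sᵢ` for complex
`z` and comparing coefficients of powers of `z` gives the polarized identity
(`sum_d2_bracket11_eq_zero`). In its coefficient of `z^(k+1)` all terms `{{Sᵢ, -}}` with `i ≥ 1`
vanish by the deformation equations, and what remains is `-2 d_T Ob` (`d2_selfBracketCoeff`).
-/

namespace HomLieConf

/-! ### Substitution of commuting endomorphisms -/

section Poly

variable {V : Type*} [AddCommGroup V] [Module ℂ V]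

/-- An identity `p(ν) = w(ν - l)` between values at complex numbers persists when an endomorphism
is substituted for `ν`. -/
lemma subst_eq_subst_sub {p w : LPoly V} {l : ℂ} (h : ∀ ν, ev ν p = ev (ν - l) w)
    (B : Module.End ℂ V) : subst B p = subst (B - l • (1 : Module.End ℂ V)) w := by
  -- Reflecting twice, with `∂` replaced by the scalar `l` and then by `0`, is the shift by `l`.
  have hs : ∀ C : Module.End ℂ V,
      subst C (reflect 0 (reflect (l • (1 : Module.End ℂ V)) w)) =
        subst (C - l • (1 : Module.End ℂ V)) w := by
    intro C
    rw [subst_reflect _ _ (by simp), subst_reflect _ _ (by simp)]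
    congr 2
    abel
  rw [← hs]
  congr 1
  refine ev_injective fun ν => ?_
  rw [h, ev, ev, hs, sub_smul]

end Poly

section Operators

variable {L M : Type*} [AddCommGroup L] [Module ℂ L] [AddCommGroup M] [Module ℂ M]
  {A : HomLieConformalAlgebra L} (R : Representation A M)

/-- Since `ρ(x)_λ ∂ = (∂ + λ) ρ(x)_λ`, the substitution `-∂ - c` inside `ρ(x)_λ` becomes the
substitution `-∂ - λ - c` outside. -/
lemma Representation.ev_act_evDual (l c : ℂ) (x : L) (q : LPoly M) :
    ev l (R.act x (evDual R.D c q)) = evDual R.D (l + c) (mapCoeff (ev l ∘ₗ R.act x) q) := by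
  refine (subst_mapCoeff (ev l ∘ₗ R.act x) _ _ (fun v => ?_) q).symm
  simp only [LinearMap.comp_apply, LinearMap.sub_apply, LinearMap.neg_apply, LinearMap.smul_apply,
    Module.End.one_apply, map_sub, map_neg, map_smul, R.act_D_right]
  module

/-- Under the outer substitution `λ = -∂ - a - b`, the operator `∂ + λ` is the scalar `-a - b`, so
that the inner substitution `-∂ - a` is evaluation at `b`. -/
lemma Representation.evDual_act_evDual (a b : ℂ) (x : L) (q : LPoly M) :
    evDual R.D (a + b) (R.act x (evDual R.D a q)) = evDual R.D (a + b) (R.act x (ev b q)) := by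
  have hD : ∀ v, evDual R.D (a + b) (R.act x ((-R.D - a • (1 : Module.End ℂ M)) v)) =
      (b • (1 : Module.End ℂ M)) (evDual R.D (a + b) (R.act x v)) := by
    intro v
    simp only [LinearMap.sub_apply, LinearMap.neg_apply, LinearMap.smul_apply,
      Module.End.one_apply, map_sub, map_neg, map_smul,
      evDual_D_right R.D (fun l => R.act_D_right l x v)]
    module
  have h1 := subst_mapCoeff (evDual R.D (a + b) ∘ₗ R.act x) _ _ hD q
  have h2 := ev_mapCoeff (evDual R.D (a + b) ∘ₗ R.act x) b q
  exact h1.symm.trans h2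

/-- The representation identity at `μ = -∂ - l - c`. -/
lemma Representation.evDual_act_br (l c : ℂ) (x y : L) (m : M) :
    evDual R.D c (R.act (ev l (A.br x y)) (R.β m)) =
      ev l (R.act (A.α x) (evDual R.D c (R.act y m)))
        - evDual R.D (l + c) (R.act (A.α y) (ev l (R.act x m))) := by
  have h : ∀ ν, ev ν (R.act (ev l (A.br x y)) (R.β m)) = ev (ν - l)
      (mapCoeff (ev l ∘ₗ R.act (A.α x)) (R.act y m) - R.act (A.α y) (ev l (R.act x m))) := by
    intro ν
    have := R.act_br l (ν - l) x y m
    rw [add_sub_cancel] at this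
    rw [this, map_sub, ev_mapCoeff, LinearMap.comp_apply]
  rw [R.ev_act_evDual, ← map_sub, evDual, subst_eq_subst_sub h, evDual, add_smul]
  congr 2
  abel

lemma ev_subadj (S : M →ₗ[ℂ] L) (l : ℂ) (m n : M) :
    ev l (subadj R S m n) = ev l (R.act (S m) n) - evDual R.D l (R.act (S n) m) := by
  simp [subadj, ev_reflect]

/-! ### The controlling bracket -/

lemma bracket11_comm (S S' : C1 R) : bracket11 R S S' = bracket11 R S' S := by
  apply Subtype.ext
  ext1 m; ext1 n
  refine ev_injective fun l => ?_
  simp only [bracket11, ev_bracket11Raw, A.skew l (S.1 m), A.skew l (S'.1 m)]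
  abel

lemma ev_bracket11_self (S : C1 R) (l : ℂ) (m n : M) :
    ev l ((bracket11 R S S).1 m n) =
      (2 : ℂ) • (S.1 (ev l (subadj R S.1 m n)) - ev l (A.br (S.1 m) (S.1 n))) := by
  rw [bracket11, ev_bracket11Raw, ← ev_subadj, A.skew l (S.1 m)]
  module

lemma evDual_C2 (P : C2 R) (l : ℂ) (m n : M) : evDual A.D l (P.1 m n) = -ev l (P.1 n m) := by
  rw [P.2.2.2.2 l n m, neg_neg]

/-- The graded Jacobi identity `{{S, {{S, S}}}} = 0` on the diagonal. The terms
`S(ρ(S b)_λ m)` and `[(S b)_λ (S m)]`, where `b = ρ(S m)_λ n - ρ(S n)_{-∂-λ} m`, cancel in pairs; the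
rest vanishes by the Hom-Jacobi identity and by the identity of the representation at `(λ₁, λ₂)` and
at two substitutions involving `λ₃`. -/
theorem d2_bracket11_self (S : C1 R) : d2 R S (bracket11 R S S) = 0 := by
  funext l₁ l₂ m₁ m₂ m₃
  have hβ : ∀ m, S.1 (R.β m) = A.α (S.1 m) := fun m => (S.2.2 m).symm
  have hbr : ∀ (l : ℂ) (x y : L), evDual A.D l (A.br x y) = -ev l (A.br y x) := fun l x y => by
    rw [A.skew l y x, neg_neg]
  change bracket12 R S.1 (bracket11 R S S).1 l₁ l₂ m₁ m₂ m₃ = 0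
  simp only [bracket12, evDual_C2, hbr, ev_bracket11_self]
  have e3 := R.act_br l₁ l₂ (S.1 m₁) (S.1 m₂) m₃
  have e2 := R.evDual_act_br l₁ l₂ (S.1 m₁) (S.1 m₃) m₂
  have e1 := R.evDual_act_br l₂ l₁ (S.1 m₂) (S.1 m₃) m₁
  -- In the last term of `e1` the inner action is evaluated at `λ₂`, in `{{S, {{S, S}}}}` at `-∂ - λ₁`.
  rw [add_comm l₂ l₁, ← R.evDual_act_evDual] at e1
  have j := A.jacobi l₁ l₂ (S.1 m₁) (S.1 m₂) (S.1 m₃)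
  simp only [ev_subadj R S.1 (l₁ + l₂), ev_subadj R S.1 l₁ (R.β m₁), ev_subadj R S.1 l₂ (R.β m₂),
    hβ, map_sub, map_smul, LinearMap.smul_apply, LinearMap.sub_apply, e1, e2, e3, j]
  simp only [ev_subadj, map_sub, LinearMap.sub_apply]
  module

/-- The bracket `{{S, S'}}` of two `1`-cochains as a bilinear map. -/
noncomputable def bracket11Bilin : C1 R →ₗ[ℂ] C1 R →ₗ[ℂ] C2 R :=
  LinearMap.mk₂ ℂ (bracket11 R)
    (fun S S' U => by
      rw [bracket11_comm, bracket11_comm R S, bracket11_comm R S']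
      exact map_add (d1 R U) S S')
    (fun c S U => by
      rw [bracket11_comm, bracket11_comm R S]
      exact map_smul (d1 R U) c S)
    (fun S => map_add (d1 R S))
    (fun c S => map_smul (d1 R S) c)

lemma bracket11Bilin_apply (S S' : C1 R) : bracket11Bilin R S S' = bracket11 R S S' := rfl

/-- The bracket `{{S, P}}` of a `1`-cochain and a `2`-cochain as a bilinear map. -/
noncomputable def bracket12Bilin : C1 R →ₗ[ℂ] C2 R →ₗ[ℂ] (ℂ → ℂ → M → M → M → L) :=
  LinearMap.mk₂ ℂ (fun S P => d2 R S P)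
    (fun S S' P => by
      have hs : ∀ m n, subadj R (S + S').1 m n = subadj R S.1 m n + subadj R S'.1 m n := by
        intro m n
        refine ev_injective fun l => ?_
        simp only [map_add, ev_subadj, Submodule.coe_add, LinearMap.add_apply]
        abel
      funext l₁ l₂ m₁ m₂ m₃
      simp only [d2, LinearMap.coe_mk, AddHom.coe_mk, Pi.add_apply, bracket12, hs]
      simp only [Submodule.coe_add, LinearMap.add_apply, map_add]
      abel)
    (fun c S P => by
      have hs : ∀ m n, subadj R (c • S).1 m n = c • subadj R S.1 m n := by
        intro m n
        refine ev_injective fun l => ?_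
        simp only [map_smul, ev_subadj, Submodule.coe_smul, LinearMap.smul_apply, smul_sub]
      funext l₁ l₂ m₁ m₂ m₃
      simp only [d2, LinearMap.coe_mk, AddHom.coe_mk, Pi.smul_apply, bracket12, hs]
      simp only [Submodule.coe_smul, LinearMap.smul_apply, map_smul, smul_add, smul_sub])
    (fun S => map_add (d2 R S))
    (fun c S => map_smul (d2 R S) c)

lemma bracket12Bilin_apply (S : C1 R) (P : C2 R) : bracket12Bilin R S P = d2 R S P := rfl

/-- The coefficient `∑_{i+j=n} {{Sᵢ, Sⱼ}}` of `tⁿ` in `{{S_t, S_t}}`, for `S_t = ∑ tⁱ Sᵢ`. -/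
noncomputable def selfBracketCoeff {k : ℕ} (S : Fin k → C1 R) (n : ℕ) : C2 R :=
  ∑ i : Fin k, ∑ j : Fin k, if (i : ℕ) + j = n then bracket11 R (S i) (S j) else 0

/-- The polarized graded Jacobi identity, in the form of the vanishing of the coefficients of
`{{S_z, {{S_z, S_z}}}}` for `S_z = ∑ zⁱ Sᵢ`. -/
lemma sum_d2_bracket11_eq_zero {k : ℕ} (S : Fin k → C1 R) (n : ℕ) :
    ∑ i : Fin k, d2 R (S i) (∑ j : Fin k, ∑ l : Fin k,
      if (i : ℕ) + ((j : ℕ) + l) = n then bracket11 R (S j) (S l) else 0) = 0 := by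
  -- A polynomial in `z` whose values are all zero has zero coefficients.
  let p : LPoly (ℂ → ℂ → M → M → M → L) := ∑ i : Fin k, ∑ j : Fin k, ∑ l : Fin k,
    Finsupp.single ((i : ℕ) + ((j : ℕ) + l)) (d2 R (S i) (bracket11 R (S j) (S l)))
  have hp : p = 0 := by
    refine ev_injective fun z => ?_
    have h := d2_bracket11_self R (∑ i : Fin k, z ^ (i : ℕ) • S i)
    rw [← bracket12Bilin_apply, ← bracket11Bilin_apply] at h
    simp only [map_sum, map_smul, LinearMap.sum_apply, LinearMap.smul_apply, Finset.smul_sum,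
      smul_smul, bracket12Bilin_apply, bracket11Bilin_apply] at h
    rw [map_zero, ← h]
    simp only [p, map_sum, ev, subst_single, smul_pow, one_pow, LinearMap.smul_apply,
      Module.End.one_apply]
    -- The expansion in `h` has the order of summation reversed.
    rw [Finset.sum_comm, Finset.sum_congr rfl fun j _ => Finset.sum_comm, Finset.sum_comm]
    refine Finset.sum_congr rfl fun l _ => Finset.sum_congr rfl fun j _ =>
      Finset.sum_congr rfl fun i _ => ?_
    congr 1
    ring
  have := congrArg (fun q => q n) hp
  simp only [p, Finsupp.finsetSum_apply, Finsupp.single_apply, Finsupp.zero_apply] at this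
  simpa only [map_sum, apply_ite, map_zero] using this

lemma isOOperator_iff_bracket11_self (S : C1 R) :
    IsOOperator R (S : M →ₗ[ℂ] L) ↔ bracket11 R S S = 0 := by
  have key : ∀ l m n, ev l ((bracket11 R S S).1 m n) = 0 ↔ ev l (A.br (S.1 m) (S.1 n)) =
      S.1 (ev l (R.act (S.1 m) n) - evDual R.D l (R.act (S.1 n) m)) := by
    intro l m n
    rw [ev_bracket11_self, smul_eq_zero_iff_right two_ne_zero, sub_eq_zero, ev_subadj, eq_comm]
  constructor
  · intro h
    apply Subtype.ext
    ext1 m; ext1 n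
    refine ev_injective fun l => ?_
    rw [(key l m n).2 (h.eq l m n)]
    simp
  · intro h
    refine ⟨S.2.1, fun m => (S.2.2 m).symm, fun l m n => (key l m n).1 ?_⟩
    rw [h]
    simp

end Operators

/-! ### The equations of a deformation, order by order -/

section Extension

variable {L M : Type*} [AddCommGroup L] [Module ℂ L] [AddCommGroup M] [Module ℂ M]
  {A : HomLieConformalAlgebra L} (R : Representation A M)

lemma tpow_apply {V : Type*} [AddCommGroup V] [Module ℂ V] (k n : ℕ) (v : V) (i : Fin (k + 1)) :
    tpow k n v i = if n = i then v else 0 := by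
  unfold tpow
  split_ifs with h h' h'
  · subst h'; simp
  · rw [LinearMap.single_apply, Pi.single_eq_of_ne]
    rintro rfl; exact h' rfl
  · omega
  · simp

lemma series_tpow {V W : Type*} [AddCommGroup V] [Module ℂ V] [AddCommGroup W] [Module ℂ W]
    {k : ℕ} (T : Fin (k + 1) → V →ₗ[ℂ] W) (a : ℕ) (v : V) :
    series T (tpow k a v) = ∑ i : Fin (k + 1), tpow k ((i : ℕ) + a) (T i v) := by
  simp only [series, LinearMap.sum_apply, LinearMap.comp_apply, LinearMap.proj_apply, tpow_apply]
  refine Finset.sum_congr rfl fun i _ => ?_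
  by_cases ha : a < k + 1
  · rw [Finset.sum_eq_single ⟨a, ha⟩]
    · simp
    · intro j _ hj
      rw [if_neg (fun h => hj (Fin.ext h.symm))]
      simp
    · simp
  · rw [Finset.sum_eq_zero]
    · have h2 : ¬ (i : ℕ) + a < k + 1 := by omega
      simp [tpow, h2]
    · intro j _
      rw [if_neg (by omega)]
      simp

/-- The series `∑ tⁱ Sᵢ` of `1`-cochains, as a `1`-cochain over `ℂ[t]/t^(k+1)`. -/
noncomputable def seriesC1 {k : ℕ} (S : Fin (k + 1) → C1 R) : C1 (R.trunc k) :=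
  ⟨series fun i => (S i : M →ₗ[ℂ] L), by
    constructor
    · intro m
      induction m using tpow_induction with
      | h0 => simp
      | hadd v w hv hw => simp only [map_add, hv, hw]
      | ht a v =>
        simp only [Representation.trunc, HomLieConformalAlgebra.trunc, truncMap_tpow, series_tpow,
          map_sum, (S _).2.1]
    · intro m
      induction m using tpow_induction with
      | h0 => simp
      | hadd v w hv hw => simp only [map_add, hv, hw]
      | ht a v =>
        simp only [Representation.trunc, HomLieConformalAlgebra.trunc, truncMap_tpow, series_tpow,
          map_sum, (S _).2.2]⟩

lemma ev_bracket11_seriesC1 {k : ℕ} (S : Fin (k + 1) → C1 R) (l : ℂ) (a b : ℕ) (m n : M) :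
    ev l ((bracket11 (R.trunc k) (seriesC1 R S) (seriesC1 R S)).1 (tpow k a m) (tpow k b n)) =
      ∑ i : Fin (k + 1), ∑ j : Fin (k + 1),
        tpow k ((i : ℕ) + j + (a + b)) (ev l ((bracket11 R (S i) (S j)).1 m n)) := by
  have hR : ∀ (c : ℕ) (p : LPoly M),
      evDual (R.trunc k).D l (mapCoeff (tpow k c) p) = tpow k c (evDual R.D l p) := fun c p =>
    evDual_mapCoeff _ R.D _ (fun v => (truncMap_tpow k R.D c v).symm) l p
  have hA : ∀ (c : ℕ) (p : LPoly L),
      evDual (A.trunc k).D l (mapCoeff (tpow k c) p) = tpow k c (evDual A.D l p) := fun c p =>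
    evDual_mapCoeff _ A.D _ (fun v => (truncMap_tpow k A.D c v).symm) l p
  have hact : (R.trunc k).act = truncBilin k R.act := rfl
  have hbr : (A.trunc k).br = truncBilin k A.br := rfl
  simp only [bracket11, ev_bracket11Raw, seriesC1, series_tpow, hact, hbr, map_sum,
    LinearMap.sum_apply, truncBilin_tpow, ev_mapCoeff, hR, hA, map_sub, map_add]
  simp only [Finset.sum_add_distrib, Finset.sum_sub_distrib]
  have hcongr : ∀ f g : Fin (k + 1) → Fin (k + 1) → Fin (k + 1) → L, (∀ i j, f i j = g i j) →
      ∑ i, ∑ j, f i j = ∑ i, ∑ j, g i j := fun f g h => by simp only [h]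
  have hcomm : ∀ f g : Fin (k + 1) → Fin (k + 1) → Fin (k + 1) → L, (∀ i j, f i j = g j i) →
      ∑ i, ∑ j, f i j = ∑ i, ∑ j, g i j := fun f g h => by simp only [h]; exact Finset.sum_comm
  -- Both sides are sums of the same six families, four of them with `i` and `j` interchanged.
  refine congrArg₂ _ (congrArg₂ _ (congrArg₂ _ (congrArg₂ _ (hcomm _ _ fun i j => ?_)
    (hcomm _ _ fun i j => ?_)) (congrArg₂ _ (hcongr _ _ fun i j => ?_)
    (hcongr _ _ fun i j => ?_))) (hcomm _ _ fun i j => ?_)) (hcomm _ _ fun i j => ?_)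
  all_goals
    congr 2
    omega

/-- A series `∑ tⁱ Sᵢ` of `1`-cochains is an `O`-operator modulo `t^(k+1)` if and only if
the coefficients of `tⁿ` in `{{S_t, S_t}}` vanish for all `n ≤ k`. -/
theorem isOOperator_series_iff {k : ℕ} (S : Fin (k + 1) → C1 R) :
    IsOOperator (R.trunc k) (series fun i => (S i : M →ₗ[ℂ] L)) ↔
      ∀ n ≤ k, selfBracketCoeff R S n = 0 := by
  have hcoe : ∀ (n : ℕ) (l : ℂ) (m m' : M),
      ev l ((selfBracketCoeff R S n).1 m m') =
        ∑ i : Fin (k + 1), ∑ j : Fin (k + 1),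
          if (i : ℕ) + j = n then ev l ((bracket11 R (S i) (S j)).1 m m') else 0 := by
    intro n l m m'
    let φ : C2 R →ₗ[ℂ] L :=
      ev l ∘ₗ LinearMap.applyₗ m' ∘ₗ LinearMap.applyₗ (M₂ := M →ₗ[ℂ] LPoly L) m ∘ₗ (C2 R).subtype
    change φ _ = ∑ i : Fin (k + 1), ∑ j : Fin (k + 1),
      if (i : ℕ) + j = n then φ (bracket11 R (S i) (S j)) else 0
    simp only [selfBracketCoeff, map_sum, apply_ite φ, map_zero]
  refine (isOOperator_iff_bracket11_self (R.trunc k) (seriesC1 R S)).trans ⟨fun h n hn => ?_,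
    fun h => ?_⟩
  · apply Subtype.ext
    ext1 m; ext1 m'
    refine ev_injective fun l => ?_
    have h' := ev_bracket11_seriesC1 R S l 0 0 m m'
    rw [h] at h'
    have h'' := congrFun h' ⟨n, by omega⟩
    simp only [Finset.sum_apply, tpow_apply, add_zero] at h''
    rw [hcoe, ← h'']
    simp
  · apply Subtype.ext
    refine LinearMap.ext₂ fun v w => ev_injective fun l => ?_
    simp only [ZeroMemClass.coe_zero, LinearMap.zero_apply, map_zero]
    induction v using tpow_induction with
    | h0 => simp
    | hadd v v' hv hv' => simp only [map_add, LinearMap.add_apply, hv, hv', add_zero]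
    | ht a m =>
      induction w using tpow_induction with
      | h0 => simp
      | hadd w w' hw hw' => simp only [map_add, hw, hw', add_zero]
      | ht b m' =>
        rw [ev_bracket11_seriesC1]
        funext c
        simp only [Finset.sum_apply, tpow_apply, Pi.zero_apply]
        by_cases hc : a + b ≤ c
        · have h' := hcoe (c - (a + b)) l m m'
          rw [h _ (by omega)] at h'
          simp only [ZeroMemClass.coe_zero, LinearMap.zero_apply, map_zero] at h'
          refine Eq.trans ?_ h'.symm
          refine Finset.sum_congr rfl fun i _ => Finset.sum_congr rfl fun j _ => ?_
          exact if_congr (by omega) rfl rfl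
        · refine Finset.sum_eq_zero fun i _ => Finset.sum_eq_zero fun j _ => ?_
          rw [if_neg (by omega)]

end Extension

/-! ### The obstruction -/

section Extension

variable {L M : Type*} [AddCommGroup L] [Module ℂ L] [AddCommGroup M] [Module ℂ M]
  {A : HomLieConformalAlgebra L} (R : Representation A M)

lemma obstruction_eq (k : ℕ) (S : Fin (k + 1) → C1 R) :
    obstruction R k S = -(1 / 2 : ℂ) • selfBracketCoeff R S (k + 1) := by
  unfold obstruction selfBracketCoeff
  congr 1
  refine Finset.sum_congr rfl fun i _ => Finset.sum_congr rfl fun j _ => ?_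
  exact if_congr (by omega) rfl rfl

/-- If `{{S_t, S_t}}` vanishes modulo `t^(k+1)`, then the coefficient of `t^(k+1)` in
`{{S_t, {{S_t, S_t}}}} = 0` is `d_{S₀}` of the coefficient of `t^(k+1)` in `{{S_t, S_t}}`. -/
lemma d2_selfBracketCoeff {k : ℕ} (S : Fin (k + 1) → C1 R)
    (h : ∀ n ≤ k, selfBracketCoeff R S n = 0) :
    d2 R (S 0) (selfBracketCoeff R S (k + 1)) = 0 := by
  have hJ := sum_d2_bracket11_eq_zero R S (k + 1)
  rw [Finset.sum_eq_single 0] at hJ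
  · simpa only [Fin.val_zero, zero_add, selfBracketCoeff] using hJ
  · intro i _ hi
    have hi' : (i : ℕ) ≠ 0 := fun h0 => hi (Fin.ext h0)
    refine Eq.trans (congrArg (d2 R (S i)) ?_)
      ((congrArg (d2 R (S i)) (h (k + 1 - i) (by omega))).trans (map_zero _))
    refine Finset.sum_congr rfl fun j _ => Finset.sum_congr rfl fun l _ => ?_
    exact if_congr (by omega) rfl rfl
  · simp

lemma selfBracketCoeff_snoc_of_le {k : ℕ} (S : Fin (k + 1) → C1 R) (S' : C1 R) {n : ℕ}
    (hn : n ≤ k) :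
    selfBracketCoeff R (Fin.snoc (α := fun _ => C1 R) S S') n = selfBracketCoeff R S n := by
  have h1 : ∀ i : ℕ, i + (k + 1) ≠ n := by omega
  have h2 : ∀ i : ℕ, k + 1 + i ≠ n := by omega
  simp [selfBracketCoeff, Fin.sum_univ_castSucc (n := k + 1), h1, h2]

lemma selfBracketCoeff_snoc_succ {k : ℕ} (S : Fin (k + 1) → C1 R) (S' : C1 R) :
    selfBracketCoeff R (Fin.snoc (α := fun _ => C1 R) S S') (k + 1) =
      selfBracketCoeff R S (k + 1) + (2 : ℂ) • bracket11 R (S 0) S' := by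
  have h0 : ∀ f : Fin (k + 1) → C2 R, (∑ i : Fin (k + 1), if (i : ℕ) = 0 then f i else 0) = f 0 := by
    simp [Fin.val_eq_zero_iff]
  simp only [selfBracketCoeff, Fin.sum_univ_castSucc (n := k + 1), Fin.snoc_castSucc,
    Fin.snoc_last, Fin.val_castSucc, Fin.val_last, Finset.sum_add_distrib, add_eq_right,
    add_eq_left, h0, Nat.succ_ne_zero, if_false, add_zero]
  rw [bracket11_comm R S', two_smul]
  abel

theorem isDeformation_iff (T : C1 R) {k : ℕ} (S : Fin (k + 1) → C1 R) :
    IsDeformation R T k S ↔ S 0 = T ∧ ∀ n ≤ k, selfBracketCoeff R S n = 0 :=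
  ⟨fun h => ⟨h.zero, (isOOperator_series_iff R S).1 h.isOOperator⟩,
    fun h => ⟨h.1, (isOOperator_series_iff R S).2 h.2⟩⟩

theorem obstruction_mem_Z2 {T : C1 R} {k : ℕ} {S : Fin (k + 1) → C1 R}
    (h : IsDeformation R T k S) : obstruction R k S ∈ Z2 R T := by
  obtain ⟨rfl, hS⟩ := (isDeformation_iff R T S).1 h
  rw [obstruction_eq]
  exact (Z2 R (S 0)).smul_mem _ (d2_selfBracketCoeff R S hS)

/-- A term `t^(k+1) S'` extends a deformation of order `k` if and only if `d_T S'` is the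
obstruction. -/
theorem extensible_iff_obstruction_mem_B2 {T : C1 R} {k : ℕ} {S : Fin (k + 1) → C1 R}
    (h : IsDeformation R T k S) : Extensible R T k S ↔ obstruction R k S ∈ B2 R T := by
  obtain ⟨rfl, hS⟩ := (isDeformation_iff R T S).1 h
  refine exists_congr fun S' => ?_
  have hz : (Fin.snoc (α := fun _ => C1 R) S S' : Fin (k + 1 + 1) → C1 R) 0 = S 0 :=
    Fin.snoc_castSucc (α := fun _ => C1 R) (i := 0) S' S
  have heq : selfBracketCoeff R (Fin.snoc (α := fun _ => C1 R) S S') (k + 1) = 0 ↔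
      d1 R (S 0) S' = obstruction R k S := by
    rw [selfBracketCoeff_snoc_succ, obstruction_eq, ← sub_eq_zero (a := d1 R (S 0) S')]
    have : selfBracketCoeff R S (k + 1) + (2 : ℂ) • bracket11 R (S 0) S' =
        (2 : ℂ) • (d1 R (S 0) S' - -(1 / 2 : ℂ) • selfBracketCoeff R S (k + 1)) := by
      change _ + (2 : ℂ) • d1 R (S 0) S' = _
      module
    rw [this, smul_eq_zero_iff_right two_ne_zero]
  rw [isDeformation_iff, hz, ← heq]
  refine ⟨fun h' => h'.2 _ le_rfl, fun h' => ⟨rfl, fun n hn => ?_⟩⟩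
  rcases Nat.le_succ_iff.1 hn with hn | rfl
  · rw [selfBracketCoeff_snoc_of_le R S S' hn, hS n hn]
  · exact h'

end Extension
end HomLieConf

theorem mainTheorem4 {L M : Type*} [AddCommGroup L] [Module ℂ L] [AddCommGroup M] [Module ℂ M]
    (A : HomLieConf.HomLieConformalAlgebra L) (R : HomLieConf.Representation A M)
    (T : HomLieConf.C1 R) (hT : HomLieConf.IsOOperator R (T : M →ₗ[ℂ] L)) :
    (∀ (k : ℕ) (Ts : Fin (k + 1) → HomLieConf.C1 R), HomLieConf.IsDeformation R T k Ts →
      ∃ hOb : HomLieConf.obstruction R k Ts ∈ HomLieConf.Z2 R T,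
        (HomLieConf.Extensible R T k Ts ↔
          (Submodule.Quotient.mk ⟨HomLieConf.obstruction R k Ts, hOb⟩ : HomLieConf.H2 R T) = 0)) ∧
    (Subsingleton (HomLieConf.H2 R T) →
      ∀ (k : ℕ) (Ts : Fin (k + 1) → HomLieConf.C1 R), HomLieConf.IsDeformation R T k Ts →
        HomLieConf.Extensible R T k Ts) := by
  have h1 : ∀ (k : ℕ) (Ts : Fin (k + 1) → HomLieConf.C1 R), HomLieConf.IsDeformation R T k Ts →
      ∃ hOb : HomLieConf.obstruction R k Ts ∈ HomLieConf.Z2 R T,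
        (HomLieConf.Extensible R T k Ts ↔
          (Submodule.Quotient.mk ⟨HomLieConf.obstruction R k Ts, hOb⟩ : HomLieConf.H2 R T) = 0) :=
    fun k Ts h => ⟨HomLieConf.obstruction_mem_Z2 R h, by
      rw [HomLieConf.extensible_iff_obstruction_mem_B2 R h, Submodule.Quotient.mk_eq_zero]
      rfl⟩
  refine ⟨h1, fun _ k Ts h => ?_⟩
  obtain ⟨_, hext⟩ := h1 k Ts h
  exact hext.2 (Subsingleton.elim _ _)
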